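/- Let $M$ be a nonempty compact (Hausdorff) smooth manifold without boundary, $G$ a finite-dimensional real Lie group with Lie algebra $\mathfrak g=T_1G$ (a complex Lie group is regarded as a real one), and $\pi:P\to M$ a smooth principal $G$-bundle with right action $R_g(p)=p\cdot g$. Let $\Omega^2_{heq}(P;\mathfrak g)$ be the space of smooth $\mathfrak g$-valued $2$-forms $\omega$ on $P$ which are horizontal ($\omega_p(v,w)=0$ whenever $d\pi_p(v)=0$) and equivariant ($R_g^*\omega=\operatorname{Ad}(g^{-1})\circ\omega$ for all $g\in G$); it is a $C^\infty(M)$-module by $(f\omega)_p=f(\pi(p))\,\omega_p$, in particular a real vector space. Let $$\operatorname{YMT}_G(P)=\operatorname{Hom}_{\mathbb R}\bigl(\Omega^2_{heq}(P;\mathfrak g)\otimes_{\mathbb R}\Omega^2_{heq}(P;\mathfrak g),\,C^\infty(M)\bigr),$$ $$\operatorname{YMT}_{G,0}(P)=\operatorname{Hom}_{C^\infty(M)}\bigl(\Omega^2_{heq}(P;\mathfrak g)\otimes_{C^\infty(M)}\Omega^2_{heq}(P;\mathfrak g),\,C^\infty(M)\bigr)$$ be the spaces of $\mathbb R$-linear,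 respectively $C^\infty(M)$-linear, Yang--Mills-type pairings (the Yang--Mills-type theories, respectively linear Yang--Mills-type theories, with gauge group $G$ and instanton sector $P$). (1) If $G$ is not discrete and $\dim M\ge 2$, then $\operatorname{YMT}_G(P)$ and $\operatorname{YMT}_{G,0}(P)$ are infinite-dimensional real vector spaces, and $\operatorname{YMT}_{G,0}(P)$ is a projective $C^\infty(M)$-module of finite rank, i.e. finitely generated and projective. (2) If $G$ is discrete or $\dim M\le 1$, then $\operatorname{YMT}_G(P)=0$ and $\operatorname{YMT}_{G,0}(P)=0$. -/

import Mathlib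

open scoped Manifold ContDiff TensorProduct RightActions

noncomputable section

section Defs

variable {EM : Type*} [NormedAddCommGroup EM] [NormedSpace ℝ EM]
  {EG : Type*} [NormedAddCommGroup EG] [NormedSpace ℝ EG]
  {EP : Type*} [NormedAddCommGroup EP] [NormedSpace ℝ EP]

/-- The adjoint action `Ad g` of a Lie group on its Lie algebra `𝔤 = T₁G`: the derivative at `1`
of the conjugation `h ↦ g h g⁻¹`. The tangent space `T₁G` of a manifold modelled on `EG` is, by
definition, `EG` (read in the preferred chart at `1`), and it is written so here. -/
def lieAd {G : Type*} [TopologicalSpace G] [ChartedSpace EG G] [Group G] (g : G) :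
    EG →L[ℝ] EG :=
  (mfderiv 𝓘(ℝ, EG) 𝓘(ℝ, EG) (fun h : G => g * h * g⁻¹) 1 :
    TangentSpace 𝓘(ℝ, EG) (1 : G) →L[ℝ] TangentSpace 𝓘(ℝ, EG) (g * 1 * g⁻¹))

/-- A smooth principal `G`-bundle structure on the manifold `P` over the manifold `M`, for the
given right action `p <• g` of `G` on `P`: a smooth projection, a smooth fibrewise action, and
`G`-equivariant smooth local trivializations `π⁻¹(U) ≃ U × G`. -/
structure SmoothPrincipalBundle (M : Type*) [TopologicalSpace M] [ChartedSpace EM M]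
    (G : Type*) [TopologicalSpace G] [ChartedSpace EG G] [Group G]
    (P : Type*) [TopologicalSpace P] [ChartedSpace EP P] [MulAction Gᵐᵒᵖ P] where
  /-- the bundle projection -/
  proj : P → M
  contMDiff_proj : ContMDiff 𝓘(ℝ, EP) 𝓘(ℝ, EM) ∞ proj
  contMDiff_act : ContMDiff (𝓘(ℝ, EP).prod 𝓘(ℝ, EG)) 𝓘(ℝ, EP) ∞ (fun x : P × G => x.1 <• x.2)
  proj_act : ∀ (p : P) (g : G), proj (p <• g) = proj p
  exists_trivialization : ∀ x : M, ∃ (U : Set M) (e : OpenPartialHomeomorph P (M × G)),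
    IsOpen U ∧ x ∈ U ∧ e.source = proj ⁻¹' U ∧ e.target = U ×ˢ Set.univ ∧
    ContMDiffOn 𝓘(ℝ, EP) (𝓘(ℝ, EM).prod 𝓘(ℝ, EG)) ∞ e e.source ∧
    ContMDiffOn (𝓘(ℝ, EM).prod 𝓘(ℝ, EG)) 𝓘(ℝ, EP) ∞ e.symm e.target ∧
    (∀ p ∈ e.source, (e p).1 = proj p) ∧
    ∀ p ∈ e.source, ∀ g : G, (e (p <• g)).2 = (e p).2 * g

variable (EG EP) in
/-- Smooth `𝔤`-valued bilinear forms on `TP`, i.e. smooth sections of the vector bundle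
`Hom(TP, Hom(TP, P × 𝔤))`. Each `α p` is a curried bilinear map `TₚP × TₚP → 𝔤`. -/
abbrev LieValuedBilinForm (P : Type*) [TopologicalSpace P] [ChartedSpace EP P]
    [IsManifold 𝓘(ℝ, EP) ∞ P] : Type _ :=
  Cₛ^∞⟮𝓘(ℝ, EP); EP →L[ℝ] EP →L[ℝ] EG,
    fun p : P => TangentSpace 𝓘(ℝ, EP) p →L[ℝ] TangentSpace 𝓘(ℝ, EP) p →L[ℝ] Bundle.Trivial P EG p⟯

section Instances

variable {P : Type*} [TopologicalSpace P] [ChartedSpace EP P] [IsManifold 𝓘(ℝ, EP) ∞ P]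

instance LieValuedBilinForm.instAddCommGroup : AddCommGroup (LieValuedBilinForm EG EP P) :=
  ContMDiffSection.instAddCommGroup

instance LieValuedBilinForm.instModule : Module ℝ (LieValuedBilinForm EG EP P) :=
  ContMDiffSection.instModule

end Instances

section Forms

variable {M : Type*} [TopologicalSpace M] [ChartedSpace EM M]
  {G : Type*} [TopologicalSpace G] [ChartedSpace EG G] [Group G]
  {P : Type*} [TopologicalSpace P] [ChartedSpace EP P] [IsManifold 𝓘(ℝ, EP) ∞ P]
  [MulAction Gᵐᵒᵖ P]

/-- The space `Ω²_heq(P; 𝔤)` of smooth `𝔤`-valued 2-forms `α` on `P` that are horizontal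
(`α` vanishes as soon as one argument is vertical, i.e. in the kernel of `dπ`) and `G`-equivariant
(`R_g^* α = Ad(g⁻¹) ∘ α`), as a real vector space. -/
def HeqTwoForm (B : SmoothPrincipalBundle (EM := EM) (EG := EG) (EP := EP) M G P) :
    Submodule ℝ (LieValuedBilinForm EG EP P) where
  carrier := {α |
    (∀ (p : P) (v : TangentSpace 𝓘(ℝ, EP) p), α p v v = 0) ∧
    (∀ (p : P) (v w : TangentSpace 𝓘(ℝ, EP) p),
      mfderiv 𝓘(ℝ, EP) 𝓘(ℝ, EM) B.proj p v = 0 → α p v w = 0) ∧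
    ∀ (g : G) (p : P) (v w : TangentSpace 𝓘(ℝ, EP) p),
      α (p <• g) (mfderiv 𝓘(ℝ, EP) 𝓘(ℝ, EP) (fun q : P => q <• g) p v)
        (mfderiv 𝓘(ℝ, EP) 𝓘(ℝ, EP) (fun q : P => q <• g) p w) = lieAd g⁻¹ (α p v w)}
  zero_mem' := by
    refine ⟨fun _ _ => rfl, fun _ _ _ _ => rfl, fun g _ _ _ => ?_⟩
    exact (map_zero (lieAd g⁻¹)).symm
  add_mem' := by
    rintro a b ⟨ha, ha', ha''⟩ ⟨hb, hb', hb''⟩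
    refine ⟨fun p v => ?_, fun p v w h => ?_, fun g p v w => ?_⟩
    · exact (congrArg₂ (· + ·) (ha p v) (hb p v)).trans (add_zero (0 : EG))
    · exact (congrArg₂ (· + ·) (ha' p v w h) (hb' p v w h)).trans (add_zero (0 : EG))
    · exact (congrArg₂ (· + ·) (ha'' g p v w) (hb'' g p v w)).trans
        (map_add (lieAd g⁻¹) _ _).symm
  smul_mem' := by
    rintro c a ⟨ha, ha', ha''⟩
    refine ⟨fun p v => ?_, fun p v w h => ?_, fun g p v w => ?_⟩
    · exact (congrArg (c • ·) (ha p v)).trans (smul_zero (A := EG) c)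
    · exact (congrArg (c • ·) (ha' p v w h)).trans (smul_zero (A := EG) c)
    · exact (congrArg (c • ·) (ha'' g p v w)).trans (map_smul (lieAd g⁻¹) c _).symm

variable (B : SmoothPrincipalBundle (EM := EM) (EG := EG) (EP := EP) M G P)

instance HeqTwoForm.instAddCommGroup : AddCommGroup (HeqTwoForm B) :=
  Submodule.addCommGroup _

instance HeqTwoForm.instModuleReal : Module ℝ (HeqTwoForm B) :=
  Submodule.module _

/-- Multiplication of forms on `P` by smooth functions on `M`: `(f • α)ₚ = f(π p) αₚ`. -/
instance HeqTwoForm.instSMul : SMul C^∞⟮𝓘(ℝ, EM), M; ℝ⟯ (HeqTwoForm B) where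
  smul f α := ⟨⟨fun p => f (B.proj p) • α.1 p,
      ContMDiff.smul_section (f.contMDiff.comp B.contMDiff_proj) α.1.contMDiff⟩, by
    obtain ⟨a, ha, ha', ha''⟩ := α
    refine ⟨fun p v => ?_, fun p v w h => ?_, fun g p v w => ?_⟩
    · exact (congrArg (f (B.proj p) • ·) (ha p v)).trans (smul_zero (A := EG) _)
    · exact (congrArg (f (B.proj p) • ·) (ha' p v w h)).trans (smul_zero (A := EG) _)
    · refine (congrArg (f (B.proj (p <• g)) • ·) (ha'' g p v w)).trans ?_
      rw [B.proj_act]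
      exact (map_smul (lieAd g⁻¹) (f (B.proj p)) _).symm⟩

theorem HeqTwoForm.smul_apply (f : C^∞⟮𝓘(ℝ, EM), M; ℝ⟯) (α : HeqTwoForm B) (p : P) :
    (f • α).1 p = f (B.proj p) • α.1 p := rfl

instance HeqTwoForm.instModule : Module C^∞⟮𝓘(ℝ, EM), M; ℝ⟯ (HeqTwoForm B) where
  one_smul α := Subtype.ext (ContMDiffSection.ext fun p => one_smul ℝ (α.1 p))
  mul_smul f g α := Subtype.ext (ContMDiffSection.ext fun p =>
    mul_smul (f (B.proj p)) (g (B.proj p)) (α.1 p))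
  smul_zero f := Subtype.ext (ContMDiffSection.ext fun p =>
    smul_zero (A := TangentSpace 𝓘(ℝ, EP) p →L[ℝ] TangentSpace 𝓘(ℝ, EP) p →L[ℝ] EG) (f (B.proj p)))
  smul_add f α β := Subtype.ext (ContMDiffSection.ext fun p =>
    smul_add (f (B.proj p)) (α.1 p) (β.1 p))
  add_smul f g α := Subtype.ext (ContMDiffSection.ext fun p =>
    add_smul (f (B.proj p)) (g (B.proj p)) (α.1 p))
  zero_smul α := Subtype.ext (ContMDiffSection.ext fun p => zero_smul ℝ (α.1 p))

instance HeqTwoForm.instIsScalarTower :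
    IsScalarTower ℝ C^∞⟮𝓘(ℝ, EM), M; ℝ⟯ (HeqTwoForm B) where
  smul_assoc c f α := Subtype.ext (ContMDiffSection.ext fun p =>
    mul_smul c (f (B.proj p)) (α.1 p))

/-- `YMT_G(P)`: all `ℝ`-linear pairings `Ω²_heq(P; 𝔤) ⊗_ℝ Ω²_heq(P; 𝔤) → C^∞(M)`. -/
abbrev YMT : Type _ :=
  (HeqTwoForm B ⊗[ℝ] HeqTwoForm B) →ₗ[ℝ] C^∞⟮𝓘(ℝ, EM), M; ℝ⟯

/-- `YMT_{G,0}(P)`: all `C^∞(M)`-linear pairings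
`Ω²_heq(P; 𝔤) ⊗_{C^∞(M)} Ω²_heq(P; 𝔤) → C^∞(M)`. -/
abbrev YMTLinear : Type _ :=
  (HeqTwoForm B ⊗[C^∞⟮𝓘(ℝ, EM), M; ℝ⟯] HeqTwoForm B)
    →ₗ[C^∞⟮𝓘(ℝ, EM), M; ℝ⟯] C^∞⟮𝓘(ℝ, EM), M; ℝ⟯

end Forms

end Defs

end

/-! ### Dual bases and projectivity -/

section Algebra

/-! Horizontal equivariant forms are sections of `Λ²T*M ⊗ Ad P`, handled here through local gauges.
In a gauge `p = σ(π p) · τ(p)`, so a form is determined by its pullback along `σ`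
(`eval_eq_lieAd_localRep`); conversely, a constant alternating map, twisted by `Ad(τ⁻¹)` and cut off
by a bump function on `M`, is a global form (`cutoffForm`).

Finitely many gauges with cutoffs `ρᵢ` suffice, since `M` is compact. Cut-off components and cut-off
elementary forms recover `(∑ ρᵢ²) • α`, and `∑ ρᵢ²` is invertible, so they give a finite dual basis:
`HeqTwoForm B` is finitely generated projective, and so is the dual of its tensor square.

If `𝔤 ≠ 0` and `dim M ≥ 2`, some form `α` is nonzero, and projectivity gives a functional `φ` with
`φ α ≠ 0`. The pairings `f • (φ ⊗ φ)` take the values `f * (φ α)²` on `α ⊗ α`. These can be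
prescribed at any finite set of points where `φ α ≠ 0`, and there are infinitely many such points.
Otherwise `𝔤 = 0`, or a horizontal alternating form lives on a space of dimension at most one; then
every form vanishes. -/

theorem Module.finite_and_projective_of_dualBasis {R N ι : Type*} [CommRing R] [AddCommGroup N]
    [Module R N] [Fintype ι] (c : ι → N →ₗ[R] R) (e : ι → N)
    (h : ∀ x, ∑ i, c i x • e i = x) : Module.Finite R N ∧ Module.Projective R N := by
  have hs : Fintype.linearCombination R e ∘ₗ LinearMap.pi c = LinearMap.id := by
    ext x
    simpa [Fintype.linearCombination_apply] using h x
  refine ⟨Module.Finite.of_surjective (Fintype.linearCombination R e) fun x =>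
    ⟨LinearMap.pi c x, LinearMap.congr_fun hs x⟩, Module.Projective.of_split _ _ hs⟩

end Algebra

/-! ### Smoothness of pulled-back bilinear forms -/

section Smooth

variable {E : Type*} [NormedAddCommGroup E] [NormedSpace ℝ E]
  {F : Type*} [NormedAddCommGroup F] [NormedSpace ℝ F]
  {W : Type*} [NormedAddCommGroup W] [NormedSpace ℝ W]
  {N : Type*} [TopologicalSpace N] [ChartedSpace E N]

/-- The pullback of a bilinear map along the derivative of a vector-valued function. -/
noncomputable def mfderivPullback (f : N → F) (θ : F →L[ℝ] F →L[ℝ] W) (p : N) :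
    TangentSpace 𝓘(ℝ, E) p →L[ℝ] TangentSpace 𝓘(ℝ, E) p →L[ℝ] Bundle.Trivial N W p :=
  (ContinuousLinearMap.precomp W (mfderiv 𝓘(ℝ, E) 𝓘(ℝ, F) f p) ∘L θ) ∘L
    (mfderiv 𝓘(ℝ, E) 𝓘(ℝ, F) f p)

theorem mfderivPullback_apply (f : N → F) (θ : F →L[ℝ] F →L[ℝ] W) (p : N)
    (v w : TangentSpace 𝓘(ℝ, E) p) :
    mfderivPullback f θ p v w =
      θ (mfderiv 𝓘(ℝ, E) 𝓘(ℝ, F) f p v) (mfderiv 𝓘(ℝ, E) 𝓘(ℝ, F) f p w) := rfl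

variable [IsManifold 𝓘(ℝ, E) ∞ N]

/-- In tangent coordinates the pullback is `θ(D ·, D ·)`, where `D` is the coordinate derivative of
`f`, hence a composite of smooth operator-valued maps. -/
theorem contMDiffAt_mfderivPullback {f : N → F} {θ : N → F →L[ℝ] F →L[ℝ] W} {p₀ : N}
    (hf : ContMDiffAt 𝓘(ℝ, E) 𝓘(ℝ, F) ∞ f p₀)
    (hθ : ContMDiffAt 𝓘(ℝ, E) 𝓘(ℝ, F →L[ℝ] F →L[ℝ] W) ∞ θ p₀) :
    ContMDiffAt 𝓘(ℝ, E) (𝓘(ℝ, E).prod 𝓘(ℝ, E →L[ℝ] E →L[ℝ] W)) ∞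
      (fun p : N => Bundle.TotalSpace.mk' (E →L[ℝ] E →L[ℝ] W)
        (E := fun p : N => TangentSpace 𝓘(ℝ, E) p →L[ℝ] TangentSpace 𝓘(ℝ, E) p →L[ℝ]
          Bundle.Trivial N W p) p (mfderivPullback f (θ p) p)) p₀ := by
  rw [contMDiffAt_hom_bundle]
  refine ⟨contMDiffAt_id, ?_⟩
  have hD : ContMDiffAt 𝓘(ℝ, E) 𝓘(ℝ, E →L[ℝ] F) ∞
      (inTangentCoordinates 𝓘(ℝ, E) 𝓘(ℝ, F) id f (mfderiv 𝓘(ℝ, E) 𝓘(ℝ, F) f) p₀) p₀ :=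
    hf.mfderiv_const (by simp)
  have := ((hD.clm_precomp (F₃ := W)).clm_comp hθ).clm_comp hD
  refine this.congr_of_eventuallyEq ?_
  have hb := (trivializationAt E (TangentSpace 𝓘(ℝ, E)) p₀).open_baseSet.mem_nhds
    (FiberBundle.mem_baseSet_trivializationAt' p₀)
  filter_upwards [hb] with p hp
  have hp' : p ∈ (trivializationAt (E →L[ℝ] W) (fun p : N => TangentSpace 𝓘(ℝ, E) p →L[ℝ]
          Bundle.Trivial N W p) p₀).baseSet := by
    simpa using hp
  ext v w
  simp only [ContinuousLinearMap.inCoordinates, inTangentCoordinates,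
    ContinuousLinearMap.comp_apply, ContinuousLinearMap.precomp_apply,
    Bundle.Trivialization.continuousLinearMapAt_apply, Bundle.Trivialization.linearMapAt_apply, hp',
    if_true, hom_trivializationAt_apply]
  simp [mfderivPullback_apply, chartAt_self_eq]

end Smooth

/-! ### The adjoint representation and its smoothness -/

section Ad
variable {EG : Type*} [NormedAddCommGroup EG] [NormedSpace ℝ EG]
    {G : Type*} [TopologicalSpace G] [ChartedSpace EG G] [Group G]

theorem lieAd_one : lieAd (EG := EG) (1 : G) = ContinuousLinearMap.id ℝ EG := by
  have : (fun h : G => 1 * h * 1⁻¹) = id := by ext; simp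
  unfold lieAd
  rw [this]
  exact mfderiv_id

variable [LieGroup 𝓘(ℝ, EG) ∞ G]

theorem contMDiff_conj (g : G) : ContMDiff 𝓘(ℝ, EG) 𝓘(ℝ, EG) ∞ (fun h : G => g * h * g⁻¹) :=
  (contMDiff_const.mul contMDiff_id).mul contMDiff_const

theorem lieAd_mul (g h : G) : lieAd (EG := EG) (g * h) = lieAd g ∘L lieAd h := by
  have hc : (fun k : G => g * h * k * (g * h)⁻¹) =
      (fun k => g * k * g⁻¹) ∘ (fun k => h * k * h⁻¹) := by ext; simp [mul_assoc]
  -- The chain rule differentiates the outer map at `h * 1 * h⁻¹`, equal to `1` only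
  -- propositionally.
  have key : ∀ k : G, k = 1 → (mfderiv 𝓘(ℝ, EG) 𝓘(ℝ, EG) (fun k : G => g * k * g⁻¹) k :
      EG →L[ℝ] EG) = lieAd (EG := EG) g := by
    rintro _ rfl; rfl
  have h1 := mfderiv_comp (1 : G) (g := fun k => g * k * g⁻¹) (f := fun k => h * k * h⁻¹)
    (((contMDiff_conj (EG := EG) g).mdifferentiable (by simp)) _)
    (((contMDiff_conj (EG := EG) h).mdifferentiable (by simp)) _)
  have h2 := key (h * 1 * h⁻¹) (by simp)
  unfold lieAd at h2 ⊢
  rw [hc]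
  refine h1.trans ?_
  exact congrArg (fun L : EG →L[ℝ] EG => L ∘L lieAd (EG := EG) h) h2

/-- Conjugation is jointly smooth, so its partial derivative is smooth in tangent coordinates.
Source and target base points remain at `1`, so the coordinate changes are the identity. -/
theorem contMDiff_lieAd : ContMDiff 𝓘(ℝ, EG) 𝓘(ℝ, EG →L[ℝ] EG) ∞ (fun g : G => lieAd (EG := EG) g) := by
  intro g₀
  have h := ContMDiffAt.mfderiv (I := 𝓘(ℝ, EG)) (I' := 𝓘(ℝ, EG)) (J := 𝓘(ℝ, EG)) (m := ∞) (n := ∞)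
    (x₀ := g₀) (fun g h : G => g * h * g⁻¹) (fun _ => 1)
    (((contMDiff_fst.mul contMDiff_snd).mul contMDiff_fst.inv) _) contMDiffAt_const (by simp)
  refine h.congr_of_eventuallyEq (Filter.Eventually.of_forall fun g => ?_)
  have key : ∀ a b : G, a = 1 → b = 1 → (tangentBundleCore 𝓘(ℝ, EG) G).coordChange
      (achart EG b) (achart EG a) b = ContinuousLinearMap.id ℝ EG := by
    rintro _ _ rfl rfl
    ext v
    exact (tangentBundleCore 𝓘(ℝ, EG) G).coordChange_self _ _ (mem_achart_source EG (1 : G)) v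
  have hc := inTangentCoordinates_eq (I := 𝓘(ℝ, EG)) (I' := 𝓘(ℝ, EG)) (fun _ : G => (1 : G))
    (fun x : G => x * 1 * x⁻¹) (fun x : G => lieAd (EG := EG) x) (x₀ := g₀) (x := g)
    (by simp) (by simp)
  rw [key _ _ rfl rfl, key _ _ (by simp) (by simp)] at hc
  exact hc.symm
end Ad

/-! ### Local gauges and the derivative of the projection -/

section Gauge

variable {EM : Type*} [NormedAddCommGroup EM] [NormedSpace ℝ EM]
  {M : Type*} [TopologicalSpace M] [ChartedSpace EM M]
  {EG : Type*} [NormedAddCommGroup EG] [NormedSpace ℝ EG]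
  {G : Type*} [TopologicalSpace G] [ChartedSpace EG G] [Group G]
  {EP : Type*} [NormedAddCommGroup EP] [NormedSpace ℝ EP]
  {P : Type*} [TopologicalSpace P] [ChartedSpace EP P] [MulAction Gᵐᵒᵖ P]

namespace SmoothPrincipalBundle

variable (B : SmoothPrincipalBundle (EM := EM) (EG := EG) (EP := EP) M G P)

/-- A local gauge around `x₀`: a smooth local section `σ` of a principal bundle over an open
subset `U` of the chart domain at `x₀`, with the `G`-coordinate `τ` it induces. -/
structure LocalGauge (x₀ : M) where
  /-- the domain of the gauge -/
  U : Set M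
  isOpen_U : IsOpen U
  mem_U : x₀ ∈ U
  U_subset : U ⊆ (chartAt EM x₀).source
  /-- the local section -/
  σ : M → P
  /-- the `G`-coordinate -/
  τ : P → G
  contMDiffOn_σ : ContMDiffOn 𝓘(ℝ, EM) 𝓘(ℝ, EP) ∞ σ U
  contMDiffOn_τ : ContMDiffOn 𝓘(ℝ, EP) 𝓘(ℝ, EG) ∞ τ (B.proj ⁻¹' U)
  proj_σ : ∀ x ∈ U, B.proj (σ x) = x
  τ_σ : ∀ x ∈ U, τ (σ x) = 1
  τ_act : ∀ p, B.proj p ∈ U → ∀ g : G, τ (p <• g) = τ p * g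
  σ_act : ∀ p, B.proj p ∈ U → σ (B.proj p) <• τ p = p

/-- From a trivialization `e`, take `σ x = e⁻¹(x, 1)` and let `τ` be the second component of `e`;
injectivity of `e` gives `σ (π p) · τ p = p`. -/
theorem nonempty_localGauge (x₀ : M) : Nonempty (B.LocalGauge x₀) := by
  obtain ⟨U, e, hU, hx, hs, ht, he, he', hfst, hsnd⟩ := B.exists_trivialization x₀
  have hsec : ∀ x ∈ U, e.symm (x, (1 : G)) ∈ e.source ∧ e (e.symm (x, 1)) = (x, 1) := fun x hx =>
    have : (x, (1 : G)) ∈ e.target := by rw [ht]; exact ⟨hx, trivial⟩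
    ⟨e.map_target this, e.right_inv this⟩
  have hproj : ∀ x ∈ U, B.proj (e.symm (x, (1 : G))) = x := fun x hx => by
    rw [← hfst _ (hsec x hx).1, (hsec x hx).2]
  have hmem : ∀ p, B.proj p ∈ U → p ∈ e.source := fun p hp => by rw [hs]; exact hp
  refine ⟨⟨U ∩ (chartAt EM x₀).source, hU.inter (chartAt EM x₀).open_source,
    ⟨hx, mem_chart_source EM x₀⟩, Set.inter_subset_right, fun x => e.symm (x, 1),
    fun p => (e p).2, ?_, ?_, fun x hx => hproj x hx.1, fun x hx => by rw [(hsec x hx.1).2],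
    fun p hp g => hsnd p (hmem p hp.1) g, fun p hp => ?_⟩⟩
  · refine he'.comp (g := e.symm) (f := fun x : M => (x, (1 : G)))
      (contMDiff_id.prodMk contMDiff_const).contMDiffOn ?_
    intro x hx
    rw [ht]
    exact ⟨hx.1, trivial⟩
  · refine (contMDiff_snd.comp_contMDiffOn he).mono ?_
    intro p hp
    exact hmem p hp.1
  · have hq := hsec _ hp.1
    have hp' := hmem p hp.1
    have h1 : e.symm (B.proj p, (1 : G)) <• (e p).2 ∈ e.source := by
      apply hmem
      rw [B.proj_act, hproj _ hp.1]
      exact hp.1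
    refine e.injOn h1 hp' (Prod.ext ?_ ?_)
    · rw [hfst _ h1, hfst _ hp', B.proj_act, hproj _ hp.1]
    · rw [hsnd _ hq.1, hq.2, one_mul]

theorem contMDiff_rightMul
    (B : SmoothPrincipalBundle (EM := EM) (EG := EG) (EP := EP) M G P) (g : G) :
    ContMDiff 𝓘(ℝ, EP) 𝓘(ℝ, EP) ∞ (fun q : P => q <• g) :=
  B.contMDiff_act.comp (contMDiff_id.prodMk contMDiff_const)

variable {B} {x₀ : M} (𝒢 : B.LocalGauge x₀)

/-- The local section of a gauge, read in the chart of the base. -/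
noncomputable def LocalGauge.chartSection (y : EM) : P := 𝒢.σ ((extChartAt 𝓘(ℝ, EM) x₀).symm y)

theorem LocalGauge.chartSection_extChartAt {x : M} (hx : x ∈ 𝒢.U) :
    𝒢.chartSection (extChartAt 𝓘(ℝ, EM) x₀ x) = 𝒢.σ x := by
  unfold LocalGauge.chartSection
  rw [(extChartAt 𝓘(ℝ, EM) x₀).left_inv (by simpa using 𝒢.U_subset hx)]

end SmoothPrincipalBundle

variable {B : SmoothPrincipalBundle (EM := EM) (EG := EG) (EP := EP) M G P} {x₀ : M}

open SmoothPrincipalBundle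

variable (B x₀) in
/-- The chart of `M` at `x₀`, read on the total space of the bundle. -/
noncomputable def baseChart (p : P) : EM := extChartAt 𝓘(ℝ, EM) x₀ (B.proj p)

variable (B) in
/-- The derivative of the bundle projection, as a map between model spaces. -/
noncomputable def projDeriv (p : P) : EP →L[ℝ] EM :=
  (mfderiv 𝓘(ℝ, EP) 𝓘(ℝ, EM) B.proj p :
    TangentSpace 𝓘(ℝ, EP) p →L[ℝ] TangentSpace 𝓘(ℝ, EM) (B.proj p))

variable (B x₀) in
/-- The derivative of `baseChart`, as a map between model spaces. -/
noncomputable def baseDeriv (p : P) : EP →L[ℝ] EM :=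
  (mfderiv 𝓘(ℝ, EP) 𝓘(ℝ, EM) (baseChart B x₀) p :
    TangentSpace 𝓘(ℝ, EP) p →L[ℝ] TangentSpace 𝓘(ℝ, EM) (baseChart B x₀ p))

variable (EP) in
/-- The derivative of a right translation, as a map between model spaces. -/
noncomputable def actDeriv (g : G) (p : P) : EP →L[ℝ] EP :=
  (mfderiv 𝓘(ℝ, EP) 𝓘(ℝ, EP) (fun q : P => q <• g) p :
    TangentSpace 𝓘(ℝ, EP) p →L[ℝ] TangentSpace 𝓘(ℝ, EP) (p <• g))

variable [IsManifold 𝓘(ℝ, EM) ∞ M]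

theorem contMDiffAt_baseChart {p : P} (hp : B.proj p ∈ (chartAt EM x₀).source) :
    ContMDiffAt 𝓘(ℝ, EP) 𝓘(ℝ, EM) ∞ (baseChart B x₀) p :=
  (contMDiffAt_extChartAt' hp).comp p (B.contMDiff_proj p)

theorem baseDeriv_eq_zero_iff {p : P} (hp : B.proj p ∈ (chartAt EM x₀).source) (v : EP) :
    baseDeriv B x₀ p v = 0 ↔ projDeriv B p v = 0 := by
  have h : baseDeriv B x₀ p v = (mfderiv 𝓘(ℝ, EM) 𝓘(ℝ, EM) (extChartAt 𝓘(ℝ, EM) x₀) (B.proj p))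
      (projDeriv B p v) :=
    mfderiv_comp_apply p (g := extChartAt 𝓘(ℝ, EM) x₀) (f := B.proj)
      ((contMDiffAt_extChartAt' (n := ∞) hp).mdifferentiableAt (by simp))
      ((B.contMDiff_proj p).mdifferentiableAt (by simp)) v
  have hinv := isInvertible_mfderiv_extChartAt (I := 𝓘(ℝ, EM)) (x := x₀) (y := B.proj p)
    (by simpa using hp)
  rw [h]
  exact map_eq_zero_iff _ hinv.injective

theorem baseDeriv_actDeriv {p : P} (hp : B.proj p ∈ (chartAt EM x₀).source) (g : G) (v : EP) :
    baseDeriv B x₀ (p <• g) (actDeriv EP g p v) = baseDeriv B x₀ p v := by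
  have h := mfderiv_comp_apply p (g := baseChart B x₀) (f := fun q : P => q <• g)
    ((contMDiffAt_baseChart (by rwa [B.proj_act])).mdifferentiableAt (by simp))
    ((B.contMDiff_rightMul g p).mdifferentiableAt (by simp)) v
  have hc : baseChart B x₀ ∘ (fun q : P => q <• g) = baseChart B x₀ := by
    ext q
    simp [baseChart, B.proj_act]
  rw [hc] at h
  exact h.symm

namespace SmoothPrincipalBundle.LocalGauge

variable (𝒢 : B.LocalGauge x₀)

theorem contMDiffAt_chartSection {x : M} (hx : x ∈ 𝒢.U) :
    ContMDiffAt 𝓘(ℝ, EM) 𝓘(ℝ, EP) ∞ 𝒢.chartSection (extChartAt 𝓘(ℝ, EM) x₀ x) := by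
  have hs : x ∈ (extChartAt 𝓘(ℝ, EM) x₀).source := by simpa using 𝒢.U_subset hx
  refine ContMDiffAt.comp (I' := 𝓘(ℝ, EM)) _ (g := 𝒢.σ) (f := (extChartAt 𝓘(ℝ, EM) x₀).symm) ?_ ?_
  · rw [(extChartAt 𝓘(ℝ, EM) x₀).left_inv hs]
    exact 𝒢.contMDiffOn_σ.contMDiffAt (𝒢.isOpen_U.mem_nhds hx)
  · exact (contMDiffOn_extChartAt_symm x₀).contMDiffAt
      (extChartAt_target_mem_nhds' ((extChartAt 𝓘(ℝ, EM) x₀).map_source hs))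

/-- The lift to `TP` of the coordinate vector fields of the base. -/
noncomputable def lift (x : M) : EM →L[ℝ] EP :=
  (mfderiv 𝓘(ℝ, EM) 𝓘(ℝ, EP) 𝒢.chartSection (extChartAt 𝓘(ℝ, EM) x₀ x) :
    TangentSpace 𝓘(ℝ, EM) (extChartAt 𝓘(ℝ, EM) x₀ x) →L[ℝ]
      TangentSpace 𝓘(ℝ, EP) (𝒢.chartSection (extChartAt 𝓘(ℝ, EM) x₀ x)))

/-- Near the point, `σ` read in the chart is a section of `baseChart`; differentiate the resulting
identity. -/
theorem baseDeriv_lift {x : M} (hx : x ∈ 𝒢.U) (a : EM) :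
    baseDeriv B x₀ (𝒢.σ x) (𝒢.lift x a) = a := by
  have hs : x ∈ (extChartAt 𝓘(ℝ, EM) x₀).source := by simpa using 𝒢.U_subset hx
  have hev : baseChart B x₀ ∘ 𝒢.chartSection =ᶠ[nhds (extChartAt 𝓘(ℝ, EM) x₀ x)] id := by
    have h1 : (extChartAt 𝓘(ℝ, EM) x₀).target ∈ nhds (extChartAt 𝓘(ℝ, EM) x₀ x) :=
      extChartAt_target_mem_nhds' ((extChartAt 𝓘(ℝ, EM) x₀).map_source hs)
    have h2 : (extChartAt 𝓘(ℝ, EM) x₀).symm ⁻¹' 𝒢.U ∈ nhds (extChartAt 𝓘(ℝ, EM) x₀ x) :=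
      (continuousAt_extChartAt_symm' hs).preimage_mem_nhds (by
        rw [(extChartAt 𝓘(ℝ, EM) x₀).left_inv hs]; exact 𝒢.isOpen_U.mem_nhds hx)
    filter_upwards [h1, h2] with y hy hy'
    simp only [Function.comp_apply, baseChart, chartSection, id]
    rw [𝒢.proj_σ _ hy', (extChartAt 𝓘(ℝ, EM) x₀).right_inv hy]
  have hq := 𝒢.chartSection_extChartAt hx
  have h := mfderiv_comp_apply (extChartAt 𝓘(ℝ, EM) x₀ x) (g := baseChart B x₀)
    (f := 𝒢.chartSection)
    ((contMDiffAt_baseChart (by rw [hq, 𝒢.proj_σ x hx]; exact 𝒢.U_subset hx)).mdifferentiableAt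
      (by simp))
    ((𝒢.contMDiffAt_chartSection hx).mdifferentiableAt (by simp)) a
  rw [hev.mfderiv_eq, mfderiv_id] at h
  rw [← hq]
  exact h.symm

end SmoothPrincipalBundle.LocalGauge
end Gauge

/-! ### Forms in a local gauge and their components -/

section Forms

variable {EM : Type*} [NormedAddCommGroup EM] [NormedSpace ℝ EM]
  {M : Type*} [TopologicalSpace M] [ChartedSpace EM M]
  {EG : Type*} [NormedAddCommGroup EG] [NormedSpace ℝ EG]
  {G : Type*} [TopologicalSpace G] [ChartedSpace EG G] [Group G]
  {EP : Type*} [NormedAddCommGroup EP] [NormedSpace ℝ EP]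
  {P : Type*} [TopologicalSpace P] [ChartedSpace EP P] [IsManifold 𝓘(ℝ, EP) ∞ P]
  [MulAction Gᵐᵒᵖ P]
  {B : SmoothPrincipalBundle (EM := EM) (EG := EG) (EP := EP) M G P} {x₀ : M}

namespace HeqTwoForm

variable (α : HeqTwoForm B)

/-- The value of a form at a point, as a bilinear map on the model space. -/
noncomputable def eval (p : P) : EP →L[ℝ] EP →L[ℝ] EG := α.1 p

theorem eval_self (p : P) (v : EP) : eval α p v v = 0 := α.2.1 p v

theorem eval_swap (p : P) (v w : EP) : eval α p v w = -eval α p w v := by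
  have h := eval_self α p (v + w)
  simp only [map_add, add_apply, eval_self, zero_add, add_zero] at h
  exact eq_neg_of_add_eq_zero_left ((add_comm _ _).trans h)

theorem eval_congr_left {p : P} {v v' : EP} (w : EP)
    (h : projDeriv B p (v - v') = 0) :
    eval α p v w = eval α p v' w := by
  have h' : eval α p (v - v') w = 0 := α.2.2.1 p _ w h
  rwa [map_sub, sub_apply, sub_eq_zero] at h'

/-- Horizontality is imposed on the first slot only; antisymmetry carries it to the second. -/
theorem eval_congr {p : P} {v v' w w' : EP}
    (hv : projDeriv B p (v - v') = 0)
    (hw : projDeriv B p (w - w') = 0) :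
    eval α p v w = eval α p v' w' := by
  rw [eval_congr_left α w hv, eval_swap α, eval_congr_left α v' hw, ← eval_swap α]

theorem eval_act (g : G) (p : P) (v w : EP) :
    eval α (p <• g) (actDeriv EP g p v)
      (actDeriv EP g p w) =
      lieAd g⁻¹ (eval α p v w) := α.2.2.2 g p v w

theorem ext_eval {α β : HeqTwoForm B} (h : ∀ p v w, eval α p v w = eval β p v w) : α = β :=
  Subtype.ext (ContMDiffSection.ext fun p =>
    ContinuousLinearMap.ext fun v => ContinuousLinearMap.ext fun w => h p v w)

theorem eval_add (α β : HeqTwoForm B) (p : P) : eval (α + β) p = eval α p + eval β p := rfl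

theorem eval_smul (f : C^∞⟮𝓘(ℝ, EM), M; ℝ⟯) (p : P) :
    eval (f • α) p = f (B.proj p) • eval α p := rfl

theorem eval_zero (p : P) : eval (0 : HeqTwoForm B) p = 0 := rfl

theorem eval_sum {ι : Type*} (s : Finset ι) (α : ι → HeqTwoForm B) (p : P) :
    eval (∑ i ∈ s, α i) p = ∑ i ∈ s, eval (α i) p := by
  classical
  induction s using Finset.induction_on with
  | empty => simp [eval_zero]
  | insert i s hi ih => rw [Finset.sum_insert hi, Finset.sum_insert hi, eval_add, ih]

end HeqTwoForm

theorem contMDiff_mul_of_tsupport_subset (ρ : C^∞⟮𝓘(ℝ, EM), M; ℝ⟯) {U : Set M}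
    (hρ : tsupport ρ ⊆ U) {f : M → ℝ}
    (hf : ∀ x ∈ U, ContMDiffAt 𝓘(ℝ, EM) 𝓘(ℝ, ℝ) ∞ f x) :
    ContMDiff 𝓘(ℝ, EM) 𝓘(ℝ, ℝ) ∞ (fun x => ρ x * f x) := by
  refine contMDiff_of_tsupport fun x hx => ?_
  exact (ρ.contMDiff x).mul (hf x (hρ (tsupport_mul_subset_left hx)))

namespace SmoothPrincipalBundle.LocalGauge

variable (𝒢 : B.LocalGauge x₀)

/-- The representative of a form in a local gauge and in the chart of the base. -/
noncomputable def localRep (α : HeqTwoForm B) (x : M) : EM →L[ℝ] EM →L[ℝ] EG :=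
  (ContinuousLinearMap.precomp EG (𝒢.lift x) ∘L HeqTwoForm.eval α (𝒢.σ x)) ∘L 𝒢.lift x

theorem localRep_apply (α : HeqTwoForm B) (x : M) (a b : EM) :
    𝒢.localRep α x a b = HeqTwoForm.eval α (𝒢.σ x) (𝒢.lift x a) (𝒢.lift x b) := rfl

variable [IsManifold 𝓘(ℝ, EM) ∞ M]

/-- Each vector at `p` differs by a vertical one from the right translate by `τ p` of the lift of
its projection. Horizontality discards the difference, and equivariance produces `Ad(τ⁻¹)`. -/
theorem eval_eq_lieAd_localRep (α : HeqTwoForm B) {p : P} (hp : B.proj p ∈ 𝒢.U) (v w : EP) :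
    HeqTwoForm.eval α p v w = lieAd (𝒢.τ p)⁻¹
      (𝒢.localRep α (B.proj p) (baseDeriv B x₀ p v) (baseDeriv B x₀ p w)) := by
  -- Naming `q`, the lift and `τ p` independently of `p` allows `p` to be replaced by `q <• g`
  -- throughout.
  obtain ⟨q, hq⟩ : ∃ q, q = 𝒢.σ (B.proj p) := ⟨_, rfl⟩
  have hqp : q <• 𝒢.τ p = p := hq ▸ 𝒢.σ_act p hp
  have hqU : B.proj q ∈ (chartAt EM x₀).source := by
    rw [hq, 𝒢.proj_σ _ hp]; exact 𝒢.U_subset hp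
  have hE := fun a => 𝒢.baseDeriv_lift hp a
  rw [← hq] at hE
  rw [localRep_apply, ← hq]
  generalize 𝒢.lift (B.proj p) = E at hE
  generalize 𝒢.τ p = g at hqp
  subst hqp
  have hvert : ∀ v : EP, projDeriv B (q <• g)
      (v - actDeriv EP g q (E (baseDeriv B x₀ (q <• g) v))) = 0 := by
    intro v
    rw [← baseDeriv_eq_zero_iff (𝒢.U_subset hp), map_sub, baseDeriv_actDeriv hqU, hE, sub_self]
  rw [← HeqTwoForm.eval_act]
  exact HeqTwoForm.eval_congr α (hvert v) (hvert w)

/-- A smooth section of the form bundle is evaluated on two vector fields along `σ`, the lifts of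
constant fields, which are smooth because the derivative of the section is. -/
theorem contMDiffAt_localRep_apply (α : HeqTwoForm B) (a b : EM) {x : M} (hx : x ∈ 𝒢.U) :
    ContMDiffAt 𝓘(ℝ, EM) 𝓘(ℝ, EG) ∞ (fun x => 𝒢.localRep α x a b) x := by
  have hψ : ContMDiffAt 𝓘(ℝ, EM) 𝓘(ℝ, EM) ∞ (extChartAt 𝓘(ℝ, EM) x₀) x :=
    contMDiffAt_extChartAt' (𝒢.U_subset hx)
  have hs := 𝒢.contMDiffAt_chartSection hx
  have hsψ : ContMDiffAt 𝓘(ℝ, EM) 𝓘(ℝ, EP) ∞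
      (fun x => 𝒢.chartSection (extChartAt 𝓘(ℝ, EM) x₀ x)) x :=
    ContMDiffAt.comp (I' := 𝓘(ℝ, EM)) (g := 𝒢.chartSection) x hs hψ
  have hlift : ∀ a : EM, ContMDiffAt 𝓘(ℝ, EM) (𝓘(ℝ, EP).prod 𝓘(ℝ, EP)) ∞
      (fun x => Bundle.TotalSpace.mk' EP (E := fun p : P => TangentSpace 𝓘(ℝ, EP) p)
        (𝒢.chartSection (extChartAt 𝓘(ℝ, EM) x₀ x)) (𝒢.lift x a)) x := by
    intro a
    have hφ := ContMDiffAt.comp (I' := 𝓘(ℝ, EM)) x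
      (hs.mfderiv_const (I := 𝓘(ℝ, EM)) (I' := 𝓘(ℝ, EP)) (m := ∞) (by simp)) hψ
    have ha : ContMDiffAt 𝓘(ℝ, EM) (𝓘(ℝ, EM).prod 𝓘(ℝ, EM)) ∞
        (fun x => Bundle.TotalSpace.mk' EM (E := fun y : EM => TangentSpace 𝓘(ℝ, EM) y)
          (extChartAt 𝓘(ℝ, EM) x₀ x) a) x := by
      rw [Bundle.contMDiffAt_totalSpace]
      refine ⟨hψ, ?_⟩
      simpa using contMDiffAt_const
    exact ContMDiffAt.clm_apply_of_inCoordinates (b₁ := extChartAt 𝓘(ℝ, EM) x₀)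
      (b₂ := fun x => 𝒢.chartSection (extChartAt 𝓘(ℝ, EM) x₀ x))
      (E₁ := fun y : EM => TangentSpace 𝓘(ℝ, EM) y) (v := fun _ => a)
      (E₂ := fun p : P => TangentSpace 𝓘(ℝ, EP) p) (ϕ := fun x => 𝒢.lift x) hφ ha hsψ
  have h2 := ContMDiffAt.clm_bundle_apply₂ (F₁ := EP) (F₂ := EP) (F₃ := EG)
    (E₁ := fun p : P => TangentSpace 𝓘(ℝ, EP) p) (E₂ := fun p : P => TangentSpace 𝓘(ℝ, EP) p)
    (E₃ := Bundle.Trivial P EG) (b := fun x => 𝒢.chartSection (extChartAt 𝓘(ℝ, EM) x₀ x))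
    (ψ := fun x => α.1 (𝒢.chartSection (extChartAt 𝓘(ℝ, EM) x₀ x)))
    ((α.1.contMDiff _).comp x hsψ) (hlift a) (hlift b)
  have h3 := (Bundle.contMDiffAt_totalSpace.1 h2).2
  refine h3.congr_of_eventuallyEq ?_
  filter_upwards [𝒢.isOpen_U.mem_nhds hx] with y hy
  rw [localRep_apply, ← 𝒢.chartSection_extChartAt hy]
  rfl

variable (ρ : C^∞⟮𝓘(ℝ, EM), M; ℝ⟯) (hρ : tsupport ρ ⊆ 𝒢.U)

/-- A component of the local representative of forms, cut off by a function supported in the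
domain of the gauge. -/
noncomputable def component (ℓ : EG →L[ℝ] ℝ) (a b : EM) :
    HeqTwoForm B →ₗ[C^∞⟮𝓘(ℝ, EM), M; ℝ⟯] C^∞⟮𝓘(ℝ, EM), M; ℝ⟯ where
  toFun α := ⟨fun x => ρ x * ℓ (𝒢.localRep α x a b), contMDiff_mul_of_tsupport_subset ρ hρ
    fun _ hx => ℓ.contMDiff.contMDiffAt.comp _ (𝒢.contMDiffAt_localRep_apply α a b hx)⟩
  map_add' α β := by
    ext x
    change ρ x * ℓ (𝒢.localRep (α + β) x a b) =
      ρ x * ℓ (𝒢.localRep α x a b) + ρ x * ℓ (𝒢.localRep β x a b)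
    simp only [localRep_apply, HeqTwoForm.eval_add, add_apply, map_add]
    ring
  map_smul' f α := by
    ext x
    change ρ x * ℓ (𝒢.localRep (f • α) x a b) = f x * (ρ x * ℓ (𝒢.localRep α x a b))
    -- Outside `U` the point `σ x` need not lie over `x`, but there `ρ` vanishes.
    by_cases hx : x ∈ 𝒢.U
    · simp only [localRep_apply, HeqTwoForm.eval_smul, smul_apply, map_smul,
        𝒢.proj_σ x hx, smul_eq_mul]
      ring
    · rw [image_eq_zero_of_notMem_tsupport fun h => hx (hρ h)]
      ring

theorem component_apply (ℓ : EG →L[ℝ] ℝ) (a b : EM) (α : HeqTwoForm B) (x : M) :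
    𝒢.component ρ hρ ℓ a b α x = ρ x * ℓ (𝒢.localRep α x a b) := rfl

end SmoothPrincipalBundle.LocalGauge
end Forms

/-! ### Elementary alternating bilinear maps -/

section LinearAlgebra

variable {E F : Type*} [NormedAddCommGroup E] [NormedSpace ℝ E] [FiniteDimensional ℝ E]
  [NormedAddCommGroup F] [NormedSpace ℝ F] [FiniteDimensional ℝ F]

variable (E F) in
/-- Indices for the elementary bilinear maps `E × E → F`. -/
abbrev BilinIndex : Type :=
  Fin (Module.finrank ℝ E) × Fin (Module.finrank ℝ E) × Fin (Module.finrank ℝ F)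

variable (E) in
/-- The coordinate forms of a chosen basis. -/
noncomputable def basisCoord (i : Fin (Module.finrank ℝ E)) : E →L[ℝ] ℝ :=
  LinearMap.toContinuousLinearMap ((Module.finBasis ℝ E).coord i)

theorem sum_basisCoord_smul (v : E) : ∑ i, basisCoord E i v • Module.finBasis ℝ E i = v :=
  (Module.finBasis ℝ E).sum_repr v

/-- The elementary bilinear maps attached to chosen bases. -/
noncomputable def elemBilin (m : BilinIndex E F) : E →L[ℝ] E →L[ℝ] F :=
  (basisCoord E m.1).smulRight ((basisCoord E m.2.1).smulRight (Module.finBasis ℝ F m.2.2))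

theorem elemBilin_apply (m : BilinIndex E F) (v w : E) :
    elemBilin m v w =
      basisCoord E m.1 v • basisCoord E m.2.1 w • Module.finBasis ℝ F m.2.2 := rfl

theorem sum_elemBilin (c : E →L[ℝ] E →L[ℝ] F) (v w : E) :
    ∑ m : BilinIndex E F, basisCoord F m.2.2 (c (Module.finBasis ℝ E m.1)
      (Module.finBasis ℝ E m.2.1)) • elemBilin m v w = c v w := by
  conv_rhs => rw [← sum_basisCoord_smul v, ← sum_basisCoord_smul w]
  simp only [map_sum, map_smul, sum_apply, smul_apply,
    Fintype.sum_prod_type, elemBilin_apply, Finset.smul_sum]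
  conv_rhs => rw [Finset.sum_comm]
  refine Finset.sum_congr rfl fun i _ => ?_
  refine Finset.sum_congr rfl fun j _ => ?_
  conv_rhs => rw [← sum_basisCoord_smul (c _ _)]
  simp only [Finset.smul_sum]
  refine Finset.sum_congr rfl fun k _ => ?_
  module

/-- The alternating part of the elementary bilinear maps. -/
noncomputable def elemAlt (m : BilinIndex E F) : E →L[ℝ] E →L[ℝ] F :=
  (2⁻¹ : ℝ) • (elemBilin m - (elemBilin m).flip)

theorem elemAlt_apply (m : BilinIndex E F) (v w : E) :
    elemAlt m v w = (2⁻¹ : ℝ) • (elemBilin m v w - elemBilin m w v) := rfl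

theorem elemAlt_self (m : BilinIndex E F) (v : E) : elemAlt m v v = 0 := by
  simp [elemAlt_apply]

/-- Antisymmetrizing the expansion over `elemBilin` leaves an alternating `c` unchanged. The family
is redundant, but a dual basis needs only the reproducing identity. -/
theorem sum_elemAlt (c : E →L[ℝ] E →L[ℝ] F) (hc : ∀ v w, c v w = -c w v) (v w : E) :
    ∑ m : BilinIndex E F, basisCoord F m.2.2 (c (Module.finBasis ℝ E m.1)
      (Module.finBasis ℝ E m.2.1)) • elemAlt m v w = c v w := by
  simp only [elemAlt_apply, smul_comm _ (2⁻¹ : ℝ), ← Finset.smul_sum, smul_sub,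
    Finset.sum_sub_distrib, sum_elemBilin]
  rw [hc w v]
  module

theorem exists_alternating_ne_zero [Nontrivial F] (h : 2 ≤ Module.finrank ℝ E) :
    ∃ T : E →L[ℝ] E →L[ℝ] F, (∀ v, T v v = 0) ∧ ∃ v w, T v w ≠ 0 := by
  let i : Fin (Module.finrank ℝ E) := ⟨0, by omega⟩
  let j : Fin (Module.finrank ℝ E) := ⟨1, by omega⟩
  have hij : i ≠ j := by simp [i, j]
  let k : Fin (Module.finrank ℝ F) := ⟨0, Module.finrank_pos⟩
  refine ⟨elemAlt (i, j, k), elemAlt_self _, Module.finBasis ℝ E i, Module.finBasis ℝ E j, ?_⟩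
  simp [elemAlt_apply, elemBilin_apply, basisCoord, hij, hij.symm,
    (Module.finBasis ℝ F).ne_zero k]

end LinearAlgebra

/-! ### Cut-off extensions and the reproducing identity -/

section Forms

variable {EM : Type*} [NormedAddCommGroup EM] [NormedSpace ℝ EM]
  {M : Type*} [TopologicalSpace M] [ChartedSpace EM M] [IsManifold 𝓘(ℝ, EM) ∞ M]
  {EG : Type*} [NormedAddCommGroup EG] [NormedSpace ℝ EG]
  {G : Type*} [TopologicalSpace G] [ChartedSpace EG G] [Group G] [LieGroup 𝓘(ℝ, EG) ∞ G]
  {EP : Type*} [NormedAddCommGroup EP] [NormedSpace ℝ EP]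
  {P : Type*} [TopologicalSpace P] [ChartedSpace EP P] [IsManifold 𝓘(ℝ, EP) ∞ P]
  [MulAction Gᵐᵒᵖ P]
  {B : SmoothPrincipalBundle (EM := EM) (EG := EG) (EP := EP) M G P} {x₀ : M}

namespace SmoothPrincipalBundle.LocalGauge

variable (𝒢 : B.LocalGauge x₀) (ρ : C^∞⟮𝓘(ℝ, EM), M; ℝ⟯) (hρ : tsupport ρ ⊆ 𝒢.U)
  (T : EM →L[ℝ] EM →L[ℝ] EG)

/-- The equivariant horizontal extension of a constant bilinear map in a local gauge. -/
noncomputable def extension (p : P) :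
    TangentSpace 𝓘(ℝ, EP) p →L[ℝ] TangentSpace 𝓘(ℝ, EP) p →L[ℝ] Bundle.Trivial P EG p :=
  mfderivPullback (baseChart B x₀)
    (ContinuousLinearMap.postcomp EM (lieAd (EG := EG) (𝒢.τ p)⁻¹) ∘L T) p

theorem contMDiffAt_extension {p : P} (hp : B.proj p ∈ 𝒢.U) :
    ContMDiffAt 𝓘(ℝ, EP) (𝓘(ℝ, EP).prod 𝓘(ℝ, EP →L[ℝ] EP →L[ℝ] EG)) ∞
      (fun p : P => Bundle.TotalSpace.mk' (EP →L[ℝ] EP →L[ℝ] EG)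
        (E := fun p : P => TangentSpace 𝓘(ℝ, EP) p →L[ℝ] TangentSpace 𝓘(ℝ, EP) p →L[ℝ]
          Bundle.Trivial P EG p) p (𝒢.extension T p)) p := by
  refine contMDiffAt_mfderivPullback (contMDiffAt_baseChart (𝒢.U_subset hp)) ?_
  have hτ : ContMDiffAt 𝓘(ℝ, EP) 𝓘(ℝ, EG) ∞ 𝒢.τ p :=
    𝒢.contMDiffOn_τ.contMDiffAt
      ((𝒢.isOpen_U.preimage B.contMDiff_proj.continuous).mem_nhds hp)
  have hAd : ContMDiffAt 𝓘(ℝ, EP) 𝓘(ℝ, EG →L[ℝ] EG) ∞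
      (fun p => lieAd (EG := EG) (𝒢.τ p)⁻¹) p :=
    (contMDiff_lieAd (EG := EG) (𝒢.τ p)⁻¹).comp p hτ.inv
  exact hAd.clm_postcomp.clm_comp contMDiffAt_const

theorem contMDiff_smul_extension (hρ : tsupport ρ ⊆ 𝒢.U) :
    ContMDiff 𝓘(ℝ, EP) (𝓘(ℝ, EP).prod 𝓘(ℝ, EP →L[ℝ] EP →L[ℝ] EG)) ∞
      (fun p : P => Bundle.TotalSpace.mk' (EP →L[ℝ] EP →L[ℝ] EG)
        (E := fun p : P => TangentSpace 𝓘(ℝ, EP) p →L[ℝ] TangentSpace 𝓘(ℝ, EP) p →L[ℝ]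
          Bundle.Trivial P EG p) p (ρ (B.proj p) • 𝒢.extension T p)) := by
  intro p
  by_cases hp : B.proj p ∈ 𝒢.U
  · exact ((ρ.contMDiff.comp B.contMDiff_proj) p).smul_section (𝒢.contMDiffAt_extension T hp)
  · have hz := Bundle.contMDiff_zeroSection (n := ∞) (IB := 𝓘(ℝ, EP)) ℝ (F := EP →L[ℝ] EP →L[ℝ] EG)
      (fun p : P => TangentSpace 𝓘(ℝ, EP) p →L[ℝ] TangentSpace 𝓘(ℝ, EP) p →L[ℝ]
        Bundle.Trivial P EG p) p
    refine hz.congr_of_eventuallyEq ?_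
    have : B.proj ⁻¹' (tsupport ρ)ᶜ ∈ nhds p :=
      ((isClosed_tsupport _).isOpen_compl.preimage B.contMDiff_proj.continuous).mem_nhds
        fun h => hp (hρ h)
    filter_upwards [this] with q hq
    rw [image_eq_zero_of_notMem_tsupport hq]
    exact congrArg (Bundle.TotalSpace.mk' _ q) (zero_smul ℝ (𝒢.extension T q))

/-- The global form obtained by cutting off the extension of an alternating map. -/
noncomputable def cutoffForm (hT : ∀ v, T v v = 0) : HeqTwoForm B :=
  ⟨⟨fun p => ρ (B.proj p) • 𝒢.extension T p, 𝒢.contMDiff_smul_extension ρ T hρ⟩, by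
    refine ⟨fun p (v : EP) => ?_, fun p (v : EP) (w : EP) h => ?_,
      fun g p (v : EP) (w : EP) => ?_⟩
    · change ρ (B.proj p) • lieAd (EG := EG) (𝒢.τ p)⁻¹
        (T (baseDeriv B x₀ p v) (baseDeriv B x₀ p v)) = 0
      rw [hT, map_zero, smul_zero]
    · change ρ (B.proj p) • lieAd (EG := EG) (𝒢.τ p)⁻¹
        (T (baseDeriv B x₀ p v) (baseDeriv B x₀ p w)) = 0
      by_cases hp : B.proj p ∈ 𝒢.U
      · rw [(baseDeriv_eq_zero_iff (𝒢.U_subset hp) v).2 h, map_zero, zero_apply,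
          map_zero, smul_zero]
      · rw [image_eq_zero_of_notMem_tsupport fun h => hp (hρ h), zero_smul]
    · change ρ (B.proj (p <• g)) • lieAd (EG := EG) (𝒢.τ (p <• g))⁻¹
        (T (baseDeriv B x₀ (p <• g) (actDeriv EP g p v))
          (baseDeriv B x₀ (p <• g) (actDeriv EP g p w))) =
        lieAd g⁻¹ (ρ (B.proj p) • lieAd (EG := EG) (𝒢.τ p)⁻¹
          (T (baseDeriv B x₀ p v) (baseDeriv B x₀ p w)))
      rw [B.proj_act]
      by_cases hp : B.proj p ∈ 𝒢.U
      -- The base components are invariant under translation, so equivariance reduces to `Ad((τ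
      -- g)⁻¹) = Ad(g⁻¹) Ad(τ⁻¹)`.
      · rw [baseDeriv_actDeriv (𝒢.U_subset hp), baseDeriv_actDeriv (𝒢.U_subset hp),
          𝒢.τ_act p hp, mul_inv_rev, lieAd_mul, map_smul]
        rfl
      · rw [image_eq_zero_of_notMem_tsupport fun h => hp (hρ h), zero_smul, zero_smul, map_zero]⟩

theorem eval_cutoffForm (hT : ∀ v, T v v = 0) (p : P) (v w : EP) :
    HeqTwoForm.eval (𝒢.cutoffForm ρ hρ T hT) p v w = ρ (B.proj p) •
      lieAd (EG := EG) (𝒢.τ p)⁻¹ (T (baseDeriv B x₀ p v) (baseDeriv B x₀ p w)) := rfl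

variable [FiniteDimensional ℝ EM] [FiniteDimensional ℝ EG]

/-- Over `U` this is `sum_elemAlt` transported by `Ad(τ⁻¹)`. The coefficient and the form each carry
one factor `ρ`, whence `ρ²`. -/
theorem sum_component_smul_cutoffForm (α : HeqTwoForm B) :
    ∑ m : BilinIndex EM EG, 𝒢.component ρ hρ (basisCoord EG m.2.2) (Module.finBasis ℝ EM m.1)
      (Module.finBasis ℝ EM m.2.1) α • 𝒢.cutoffForm ρ hρ (elemAlt m) (elemAlt_self m) =
      (ρ * ρ) • α := by
  refine HeqTwoForm.ext_eval fun p v w => ?_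
  simp only [HeqTwoForm.eval_sum, HeqTwoForm.eval_smul, sum_apply,
    smul_apply, eval_cutoffForm, component_apply]
  change _ = (ρ (B.proj p) * ρ (B.proj p)) • _
  by_cases hp : B.proj p ∈ 𝒢.U
  · rw [𝒢.eval_eq_lieAd_localRep α hp, ← sum_elemAlt (𝒢.localRep α (B.proj p))
      (fun v w => HeqTwoForm.eval_swap α _ _ _), map_sum, Finset.smul_sum]
    refine Finset.sum_congr rfl fun m _ => ?_
    rw [map_smul]
    module
  · simp [image_eq_zero_of_notMem_tsupport fun h => hp (hρ h)]

end SmoothPrincipalBundle.LocalGauge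

/-! ### Global consequences: nonzero forms, projectivity, infinite dimension -/

variable [FiniteDimensional ℝ EM] [T2Space M]

variable (EM) in
theorem exists_bump {x : M} {U : Set M} (hU : U ∈ nhds x) :
    ∃ ρ : C^∞⟮𝓘(ℝ, EM), M; ℝ⟯, ρ x = 1 ∧ tsupport ρ ⊆ U := by
  obtain ⟨f, -, hf⟩ := (SmoothBumpFunction.nhds_basis_tsupport (I := 𝓘(ℝ, EM)) x).mem_iff.1 hU
  exact ⟨⟨f, f.contMDiff⟩, f.eq_one, hf⟩

variable (B) in
theorem exists_heqTwoForm_ne_zero [Nonempty M] [FiniteDimensional ℝ EG] [Nontrivial EG]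
    (h : 2 ≤ Module.finrank ℝ EM) : ∃ α : HeqTwoForm B, α ≠ 0 := by
  obtain ⟨x⟩ := ‹Nonempty M›
  obtain ⟨𝒢⟩ := B.nonempty_localGauge x
  obtain ⟨ρ, hρx, hρ⟩ := exists_bump EM (𝒢.isOpen_U.mem_nhds 𝒢.mem_U)
  obtain ⟨T, hT, v, w, hne⟩ := exists_alternating_ne_zero (F := EG) h
  refine ⟨𝒢.cutoffForm ρ hρ T hT, fun h0 => hne ?_⟩
  -- At `σ x` one has `ρ = 1` and `τ = 1`, so on lifted vectors the form is `T` itself.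
  have := 𝒢.eval_cutoffForm ρ hρ T hT (𝒢.σ x) (𝒢.lift x v) (𝒢.lift x w)
  rw [h0, 𝒢.baseDeriv_lift 𝒢.mem_U, 𝒢.baseDeriv_lift 𝒢.mem_U, 𝒢.proj_σ _ 𝒢.mem_U, hρx,
    𝒢.τ_σ _ 𝒢.mem_U, inv_one, lieAd_one, one_smul] at this
  exact this.symm

variable (B) in
theorem HeqTwoForm.finite_and_projective [CompactSpace M] [FiniteDimensional ℝ EG] :
    Module.Finite C^∞⟮𝓘(ℝ, EM), M; ℝ⟯ (HeqTwoForm B) ∧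
      Module.Projective C^∞⟮𝓘(ℝ, EM), M; ℝ⟯ (HeqTwoForm B) := by
  let 𝒢 : ∀ x, B.LocalGauge x := fun x => (B.nonempty_localGauge x).some
  choose ρ hρx hρ using fun x : M =>
    exists_bump EM ((𝒢 x).isOpen_U.mem_nhds (𝒢 x).mem_U)
  obtain ⟨t, -, ht⟩ := isCompact_univ.elim_nhds_subcover (fun x => {y | ρ x y ≠ 0}) fun x _ =>
    (isOpen_ne_fun (ρ x).contMDiff.continuous continuous_const).mem_nhds (by simp [hρx])
  let u : C^∞⟮𝓘(ℝ, EM), M; ℝ⟯ := ∑ x : t, ρ x * ρ x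
  have hu : ∀ y, u y = ∑ x : t, ρ x y * ρ x y := fun y =>
    map_sum (ContMDiffMap.evalRingHom y) _ _
  have hu0 : ∀ y, u y ≠ 0 := by
    intro y
    obtain ⟨x, hx, hxy⟩ := Set.mem_iUnion₂.1 (ht (Set.mem_univ y))
    rw [hu]
    have hpos : 0 < ρ x y * ρ x y := mul_self_pos.2 hxy
    refine (hpos.trans_le ?_).ne'
    exact Finset.single_le_sum (f := fun x : t => ρ x y * ρ x y)
      (fun _ _ => mul_self_nonneg _) (Finset.mem_univ ⟨x, hx⟩)
  -- Scaling the coefficients by `1 / ∑ ρᵢ²` takes the place of a partition of unity.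
  let u' : C^∞⟮𝓘(ℝ, EM), M; ℝ⟯ := ⟨fun y => (u y)⁻¹, u.contMDiff.inv₀ hu0⟩
  have huu : u' * u = 1 := by
    ext y
    exact inv_mul_cancel₀ (hu0 y)
  refine Module.finite_and_projective_of_dualBasis (ι := t × BilinIndex EM EG)
    (fun m => u' • (𝒢 m.1).component (ρ m.1) (hρ m.1) (basisCoord EG m.2.2.2)
      (Module.finBasis ℝ EM m.2.1) (Module.finBasis ℝ EM m.2.2.1))
    (fun m => (𝒢 m.1).cutoffForm (ρ m.1) (hρ m.1) (elemAlt m.2) (elemAlt_self m.2)) fun α => ?_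
  simp only [Fintype.sum_prod_type, LinearMap.smul_apply, smul_assoc, ← Finset.smul_sum]
  have := fun x : t => (𝒢 x).sum_component_smul_cutoffForm (ρ x) (hρ x) α
  simp only [Fintype.sum_prod_type] at this
  simp only [this, ← Finset.sum_smul]
  change u' • u • α = α
  rw [smul_smul, huu, one_smul]

variable (EM) in
/-- If `h` is a nonzero smooth function on a manifold of positive dimension, then its multiples
span an infinite-dimensional space. -/
theorem not_finiteDimensional_of_range_mul {V : Type*} [AddCommGroup V] [Module ℝ V]
    (hdim : 0 < Module.finrank ℝ EM) {h : C^∞⟮𝓘(ℝ, EM), M; ℝ⟯} (hh : h ≠ 0)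
    (L : V →ₗ[ℝ] C^∞⟮𝓘(ℝ, EM), M; ℝ⟯) (hL : ∀ f, ∃ v, L v = f * h) :
    ¬ FiniteDimensional ℝ V := by
  intro hV
  obtain ⟨x, hx⟩ : ∃ x, h x ≠ 0 := by
    by_contra! hc
    exact hh (ContMDiffMap.ext hc)
  have hinf : {y | h y ≠ 0}.Infinite := by
    have : Nontrivial EM := Module.finrank_pos_iff.1 hdim
    have hU : {y | h y ≠ 0} ∈ nhds x :=
      (isOpen_ne_fun h.contMDiff.continuous continuous_const).mem_nhds hx
    have hpre : (extChartAt 𝓘(ℝ, EM) x).symm ⁻¹' {y | h y ≠ 0} ∈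
        nhds (extChartAt 𝓘(ℝ, EM) x x) :=
      (continuousAt_extChartAt_symm x).preimage_mem_nhds (by simpa using hU)
    have htar := extChartAt_target_mem_nhds (I := 𝓘(ℝ, EM)) x
    have h1 := infinite_of_mem_nhds _ (Filter.inter_mem hpre htar)
    refine (h1.image ((extChartAt 𝓘(ℝ, EM) x).symm.injOn.mono Set.inter_subset_right)).mono ?_
    rintro _ ⟨y, hy, rfl⟩
    exact hy.1
  -- Evaluation at one point more than the dimension of `V` cannot be onto; bump functions isolating
  -- single points show that it is.
  obtain ⟨t, hts, htc⟩ := hinf.exists_subset_card_eq (Module.finrank ℝ V + 1)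
  let ev : V →ₗ[ℝ] (t → ℝ) := LinearMap.pi fun y =>
    { toFun := fun v => L v y
      map_add' := fun v w => by rw [map_add]; rfl
      map_smul' := fun c v => by rw [map_smul]; rfl }
  have hsurj : Function.Surjective ev := by
    classical
    rw [← LinearMap.range_eq_top, ← top_le_iff, ← (Pi.basisFun ℝ t).span_eq, Submodule.span_le]
    rintro _ ⟨y, rfl⟩
    have hy : h y ≠ 0 := hts y.2
    have hop : ((t.erase y : Finset M) : Set M)ᶜ ∈ nhds (y : M) :=
      (Finset.finite_toSet _).isClosed.isOpen_compl.mem_nhds (by simp)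
    obtain ⟨ρ, hρy, hρ⟩ := exists_bump EM hop
    obtain ⟨v, hv⟩ := hL ρ
    refine ⟨(h y)⁻¹ • v, ?_⟩
    ext z
    have hz : ev v z = ρ z * h z := by
      change L v z = _
      rw [hv]
      rfl
    rw [map_smul, Pi.smul_apply, hz, Pi.basisFun_apply]
    by_cases hzy : z = y
    · subst hzy
      simp [hρy, hy]
    · have : ρ z = 0 := image_eq_zero_of_notMem_tsupport fun hmem => hρ hmem (by
        simp [Subtype.coe_injective.ne hzy])
      simp [this, hzy]
  have := LinearMap.finrank_le_finrank_of_surjective hsurj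
  rw [Module.finrank_fintype_fun_eq_card, Fintype.card_coe, htc] at this
  omega

end Forms

/-! ### Degenerate cases and assembly -/

section Main

/-- A chart sends the neighbourhood `{g}` to a finite neighbourhood, impossible in a nontrivial real
normed space. -/
theorem subsingleton_of_discreteTopology_chartedSpace {E G : Type*} [NormedAddCommGroup E]
    [NormedSpace ℝ E] [TopologicalSpace G] [ChartedSpace E G] [Nonempty G] [DiscreteTopology G] :
    Subsingleton E := by
  obtain ⟨g⟩ := ‹Nonempty G›
  by_contra hne
  rw [not_subsingleton_iff_nontrivial] at hne
  have h1 : (chartAt E g).source ∩ {g} ∈ nhds g :=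
    Filter.inter_mem ((chartAt E g).open_source.mem_nhds (mem_chart_source E g)) (by simp)
  have h2 := (chartAt E g).image_mem_nhds (mem_chart_source E g) h1
  exact (infinite_of_mem_nhds _ h2) (((Set.finite_singleton g).inter_of_right _).image _)

theorem discreteTopology_of_subsingleton_chartedSpace (E : Type*) {G : Type*}
    [TopologicalSpace E] [TopologicalSpace G] [ChartedSpace E G] [Subsingleton E] :
    DiscreteTopology G := by
  refine discreteTopology_iff_isOpen_singleton.2 fun g => ?_
  have : (chartAt E g).source = {g} := by
    refine Set.eq_singleton_iff_unique_mem.2 ⟨mem_chart_source E g, fun x hx => ?_⟩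
    exact (chartAt E g).injOn hx (mem_chart_source E g) (Subsingleton.elim _ _)
  exact this ▸ (chartAt E g).open_source

variable {EM : Type*} [NormedAddCommGroup EM] [NormedSpace ℝ EM]
  {M : Type*} [TopologicalSpace M] [ChartedSpace EM M]
  {EG : Type*} [NormedAddCommGroup EG] [NormedSpace ℝ EG]
  {G : Type*} [TopologicalSpace G] [ChartedSpace EG G] [Group G]
  {EP : Type*} [NormedAddCommGroup EP] [NormedSpace ℝ EP]
  {P : Type*} [TopologicalSpace P] [ChartedSpace EP P] [IsManifold 𝓘(ℝ, EP) ∞ P]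
  [MulAction Gᵐᵒᵖ P]
  (B : SmoothPrincipalBundle (EM := EM) (EG := EG) (EP := EP) M G P)

namespace HeqTwoForm

theorem subsingleton_of_subsingleton [Subsingleton EG] : Subsingleton (HeqTwoForm B) :=
  ⟨fun _ _ => ext_eval fun _ _ _ => Subsingleton.elim _ _⟩

theorem subsingleton_of_finrank_le_one [FiniteDimensional ℝ EM]
    (h : Module.finrank ℝ EM ≤ 1) : Subsingleton (HeqTwoForm B) := by
  suffices h0 : ∀ (α : HeqTwoForm B) p v w, eval α p v w = 0 from
    ⟨fun α β => ext_eval fun p v w => (h0 α p v w).trans (h0 β p v w).symm⟩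
  intro α p v w
  obtain ⟨e, he⟩ := finrank_le_one_iff.1 h
  obtain ⟨a, ha⟩ := he (projDeriv B p v)
  obtain ⟨b, hb⟩ := he (projDeriv B p w)
  -- The projections of `v` and `w` are `a • e` and `b • e`: either `w` is vertical, or `v` agrees
  -- with `(a / b) • w` modulo vertical vectors.
  by_cases hb0 : b = 0
  · have hw : projDeriv B p (w - 0) = 0 := by rw [sub_zero, ← hb, hb0, zero_smul]
    rw [eval_congr α (v := v) (v' := v) (by simp) hw, map_zero]
  · have hv : projDeriv B p (v - (a / b) • w) = 0 := by
      rw [map_sub, map_smul, ← ha, ← hb, smul_smul, div_mul_cancel₀ a hb0, sub_self]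
    rw [eval_congr_left α w hv, map_smul, _root_.smul_apply, eval_self, smul_zero]

end HeqTwoForm

theorem subsingleton_YMT_and_YMTLinear [Subsingleton (HeqTwoForm B)] :
    Subsingleton (YMT B) ∧ Subsingleton (YMTLinear B) := by
  constructor
  · refine ⟨fun φ ψ => TensorProduct.ext' fun x y => ?_⟩
    rw [Subsingleton.elim x 0, TensorProduct.zero_tmul, map_zero, map_zero]
  · refine ⟨fun φ ψ => TensorProduct.ext' fun x y => ?_⟩
    rw [Subsingleton.elim x 0, TensorProduct.zero_tmul, map_zero, map_zero]

variable [IsManifold 𝓘(ℝ, EM) ∞ M] [FiniteDimensional ℝ EM] [T2Space M]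

theorem not_finiteDimensional_YMT_and_YMTLinear (hdim : 0 < Module.finrank ℝ EM)
    {α : HeqTwoForm B} {φ : Module.Dual C^∞⟮𝓘(ℝ, EM), M; ℝ⟯ (HeqTwoForm B)} (hφ : φ α ≠ 0) :
    ¬ FiniteDimensional ℝ (YMT B) ∧ ¬ FiniteDimensional ℝ (YMTLinear B) := by
  have hne : φ α * φ α ≠ 0 := by
    intro h0
    refine hφ (ContMDiffMap.ext fun x => ?_)
    exact mul_self_eq_zero.1 (DFunLike.congr_fun h0 x)
  constructor
  · refine not_finiteDimensional_of_range_mul EM hdim hne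
      (LinearMap.applyₗ (α ⊗ₜ[ℝ] α)) fun f => ?_
    refine ⟨TensorProduct.lift ((LinearMap.mul ℝ C^∞⟮𝓘(ℝ, EM), M; ℝ⟯).compl₁₂
      ((f • φ).restrictScalars ℝ) (φ.restrictScalars ℝ)), ?_⟩
    exact mul_assoc f (φ α) (φ α)
  · refine not_finiteDimensional_of_range_mul EM hdim hne
      { toFun := fun ψ : YMTLinear B => ψ (α ⊗ₜ α)
        map_add' := fun _ _ => rfl
        map_smul' := fun _ _ => rfl } fun f => ?_
    refine ⟨TensorProduct.lift ((LinearMap.mul C^∞⟮𝓘(ℝ, EM), M; ℝ⟯ C^∞⟮𝓘(ℝ, EM), M; ℝ⟯).compl₁₂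
      (f • φ) φ), ?_⟩
    exact mul_assoc f (φ α) (φ α)

end Main

theorem mainTheorem1
    {EM : Type*} [NormedAddCommGroup EM] [NormedSpace ℝ EM] [FiniteDimensional ℝ EM]
    {M : Type*} [TopologicalSpace M] [ChartedSpace EM M] [IsManifold 𝓘(ℝ, EM) ∞ M]
    [T2Space M] [CompactSpace M] [Nonempty M]
    {EG : Type*} [NormedAddCommGroup EG] [NormedSpace ℝ EG] [FiniteDimensional ℝ EG]
    {G : Type*} [TopologicalSpace G] [ChartedSpace EG G] [Group G] [LieGroup 𝓘(ℝ, EG) ∞ G]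
    {EP : Type*} [NormedAddCommGroup EP] [NormedSpace ℝ EP] [FiniteDimensional ℝ EP]
    {P : Type*} [TopologicalSpace P] [ChartedSpace EP P] [IsManifold 𝓘(ℝ, EP) ∞ P]
    [MulAction Gᵐᵒᵖ P]
    (B : SmoothPrincipalBundle (EM := EM) (EG := EG) (EP := EP) M G P) :
    (¬ DiscreteTopology G ∧ 2 ≤ Module.finrank ℝ EM →
      ¬ FiniteDimensional ℝ (YMT B) ∧
      ¬ FiniteDimensional ℝ (YMTLinear B) ∧
      Module.Projective C^∞⟮𝓘(ℝ, EM), M; ℝ⟯ (YMTLinear B) ∧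
      Module.Finite C^∞⟮𝓘(ℝ, EM), M; ℝ⟯ (YMTLinear B)) ∧
    (DiscreteTopology G ∨ Module.finrank ℝ EM ≤ 1 →
      Subsingleton (YMT B) ∧ Subsingleton (YMTLinear B)) := by

  refine ⟨fun ⟨hG, hM⟩ => ?_, fun h => ?_⟩
  · have : Nontrivial EG := by
      rw [← not_subsingleton_iff_nontrivial]
      exact fun _ => hG (discreteTopology_of_subsingleton_chartedSpace EG)
    obtain ⟨hfin, hproj⟩ := HeqTwoForm.finite_and_projective B
    obtain ⟨α, hα⟩ := exists_heqTwoForm_ne_zero B hM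
    -- Linear functionals on a projective module separate its elements.
    obtain ⟨φ, hφ⟩ : ∃ φ : Module.Dual C^∞⟮𝓘(ℝ, EM), M; ℝ⟯ (HeqTwoForm B), φ α ≠ 0 := by
      by_contra! hc
      exact hα ((Module.forall_dual_apply_eq_zero_iff _ α).1 hc)
    obtain ⟨h₁, h₂⟩ := not_finiteDimensional_YMT_and_YMTLinear B (by omega) hφ
    exact ⟨h₁, h₂, Module.dual_projective, Module.dual_finite⟩
  · have : Subsingleton (HeqTwoForm B) := by
      rcases h with h | h
      · have : Subsingleton EG := subsingleton_of_discreteTopology_chartedSpace (G := G)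
        exact HeqTwoForm.subsingleton_of_subsingleton B
      · exact HeqTwoForm.subsingleton_of_finrank_le_one B h
    exact subsingleton_YMT_and_YMTLinear B
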